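/- Let $d\ge 1$, let $\Omega\subset\mathbb R^d$ be a non-empty bounded open set (for instance a bounded domain), let $|\Omega|$ be its Lebesgue measure, and let $\gamma>0$. Put $$\Phi_{\exp}(t)=\begin{cases}t,&0\le t<1,\\ e^{t-1},&t\ge 1,\end{cases}\qquad \Phi_{\log}(t)=t\max(0,\ln t)\ (t>0),\quad \Phi_{\log}(0)=0 .$$ For $\Phi\in\{\Phi_{\exp},\Phi_{\log}\}$ the Orlicz space of $\Phi$ consists of the (a.e. classes of) measurable functions $f:\Omega\to\mathbb R$ with $\int_\Omega\Phi(\eta|f(x)|)\,\mathrm dx<\infty$ for some $\eta>0$, with the Luxemburg norm $$\|f\|_\Phi=\inf\Big\{k>0:\ \frac1{|\Omega|}\int_\Omega\Phi\Big(\frac{|f(x)|}{k}\Big)\,\mathrm dx\le 1\Big\}.$$ It is denoted by $L_{\exp}(\Omega)$ for $\Phi=\Phi_{\exp}$ and by $L\log L(\Omega)$ for $\Phi=\Phi_{\log}$. The space $L_{\exp}(\Omega)$ is regarded as the dual of $L\log L(\Omega)$: for $u_n,u\in L_{\exp}(\Omega)$, $u_n\rightharpoonup^* u$ in $L_{\exp}(\Omega)$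 means that $\frac1{|\Omega|}\int_\Omega u_n g\,\mathrm dx\to\frac1{|\Omega|}\int_\Omega u g\,\mathrm dx$ for every $g\in L\log L(\Omega)$. Finally, let $$\chi_\gamma(u)=\frac12\|u\|_{L^2(\Omega)}^2+\gamma\ln\Big(\frac1{|\Omega|}\int_\Omega e^{u(x)/\gamma}\,\mathrm dx\Big)+\gamma\ln\Big(\frac1{|\Omega|}\int_\Omega e^{-u(x)/\gamma}\,\mathrm dx\Big)\in\mathbb R\cup\{\infty\}$$ for $u \in L^2(\Omega)$, in particular for $u\in L_{\exp}(\Omega)$, with value $\infty$ if one of the integrals diverges. Then: 1. If $(u_n)_{n\in\mathbb N}\subset L_{\exp}(\Omega)$ and $\|u_n\|_{L_{\exp}(\Omega)}\le C$ for all $n$ and some constant $C$, then there are a subsequence $(u_n)_{n\in K}$, $K\subset\mathbb N$ infinite, and $u\in L_{\exp}(\Omega)$ such that $u_n\rightharpoonup^* u$ in $L_{\exp}(\Omega)$ and $\chi_\gamma(u)\le\liminf_{K\ni n\to\infty}\chi_\gamma(u_n)$. 2. $\chi_\gamma$ is sequentially weakly* lower semicontinuous on $L_{\exp}(\Omega)$: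 if $u_n,u\in L_{\exp}(\Omega)$ and $u_n\rightharpoonup^* u$ in $L_{\exp}(\Omega)$, then $\chi_\gamma(u)\le\liminf_{n\to\infty}\chi_\gamma(u_n)$. 3. If $(u_n)_{n\in\mathbb N}\subset L^2(\Omega)$ and there is $M\in\mathbb R$ with $\chi_\gamma(u_n)\le M$ for all $n$, then $u_n\in L_{\exp}(\Omega)$ for all $n$ and $(\|u_n\|_{L_{\exp}(\Omega)})_{n\in\mathbb N}$ is bounded. -/

import Mathlib

open MeasureTheory Filter
open scoped ENNReal NNReal Topology

noncomputable section

/-- The normalized Lebesgue measure `|Ω|⁻¹ dx` on `Ω`. -/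
def normalizedVolume {d : ℕ} (Ω : Set (EuclideanSpace ℝ (Fin d))) :
    Measure (EuclideanSpace ℝ (Fin d)) :=
  (volume Ω)⁻¹ • volume.restrict Ω

/-- Membership in the Orlicz space of the (relaxed) Young function `Φ` over the measure `μ`:
`f` is measurable and `∫ Φ(η |f|) dμ < ∞` for some `η > 0`. -/
def MemOrlicz {α : Type*} [MeasurableSpace α] (Φ : ℝ → ℝ) (f : α → ℝ) (μ : Measure α) : Prop :=
  AEStronglyMeasurable f μ ∧
    ∃ η : ℝ, 0 < η ∧ ∫⁻ x, ENNReal.ofReal (Φ (η * |f x|)) ∂μ < ∞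

/-- The Luxemburg norm `inf {k > 0 | ∫ Φ(|f| / k) dμ ≤ 1}`, with value `∞` if no such `k` exists. -/
def luxemburgNorm {α : Type*} [MeasurableSpace α] (Φ : ℝ → ℝ) (f : α → ℝ) (μ : Measure α) :
    ℝ≥0∞ :=
  ⨅ (k : ℝ) (_ : 0 < k) (_ : ∫⁻ x, ENNReal.ofReal (Φ (|f x| / k)) ∂μ ≤ 1), ENNReal.ofReal k

/-- The Young function of `L_exp`: `t` for `0 ≤ t < 1` and `e^(t - 1)` for `t ≥ 1`
(it is only ever evaluated at `t ≥ 0`). -/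
def phiExp (t : ℝ) : ℝ := if t < 1 then t else Real.exp (t - 1)

/-- The Young function of `L log L`: `t ln⁺ t`. -/
def phiLog (t : ℝ) : ℝ := t * max 0 (Real.log t)

/-- `u ∈ L_exp(Ω)`. -/
def MemLexp {d : ℕ} (Ω : Set (EuclideanSpace ℝ (Fin d))) (u : EuclideanSpace ℝ (Fin d) → ℝ) :
    Prop :=
  MemOrlicz phiExp u (normalizedVolume Ω)

/-- `g ∈ L log L(Ω)`. -/
def MemLlogL {d : ℕ} (Ω : Set (EuclideanSpace ℝ (Fin d))) (g : EuclideanSpace ℝ (Fin d) → ℝ) :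
    Prop :=
  MemOrlicz phiLog g (normalizedVolume Ω)

/-- `‖u‖` in `L_exp(Ω)`. -/
def lexpNorm {d : ℕ} (Ω : Set (EuclideanSpace ℝ (Fin d))) (u : EuclideanSpace ℝ (Fin d) → ℝ) :
    ℝ≥0∞ :=
  luxemburgNorm phiExp u (normalizedVolume Ω)

/-- Weak* convergence of `u n` to `v` in `L_exp(Ω)`, regarded as the dual of `L log L(Ω)` through
the pairing `(u, g) ↦ |Ω|⁻¹ ∫_Ω u g dx`. All functions are in `L_exp(Ω)`, so that the pairing
is an absolutely convergent integral (see `MemLexp.integrable_mul`). -/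
def TendstoWeakStarLexp {d : ℕ} (Ω : Set (EuclideanSpace ℝ (Fin d)))
    (u : ℕ → EuclideanSpace ℝ (Fin d) → ℝ) (v : EuclideanSpace ℝ (Fin d) → ℝ) : Prop :=
  (∀ n, MemLexp Ω (u n)) ∧ MemLexp Ω v ∧
    ∀ g : EuclideanSpace ℝ (Fin d) → ℝ, MemLlogL Ω g →
      Tendsto (fun n => ∫ x, u n x * g x ∂(normalizedVolume Ω)) atTop
        (𝓝 (∫ x, v x * g x ∂(normalizedVolume Ω)))

/-- The functional
`χ_γ(u) = ½ ‖u‖²_{L²(Ω)} + γ ln(|Ω|⁻¹ ∫_Ω e^{u/γ} dx) + γ ln(|Ω|⁻¹ ∫_Ω e^{-u/γ} dx)`,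
with value `∞` where one of the integrals diverges. The `L²` norm is the one of the
(non-normalized) Lebesgue measure. -/
def chi {d : ℕ} (Ω : Set (EuclideanSpace ℝ (Fin d))) (γ : ℝ)
    (u : EuclideanSpace ℝ (Fin d) → ℝ) : EReal :=
  (((1 / 2 : ℝ≥0∞) * eLpNorm u 2 (volume.restrict Ω) ^ 2 : ℝ≥0∞) : EReal)
    + (γ : EReal) *
        ENNReal.log (∫⁻ x, ENNReal.ofReal (Real.exp (γ⁻¹ * u x)) ∂(normalizedVolume Ω))
    + (γ : EReal) *
        ENNReal.log (∫⁻ x, ENNReal.ofReal (Real.exp (-(γ⁻¹ * u x))) ∂(normalizedVolume Ω))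

theorem mul_le_phiExp_add_phiLog {s t : ℝ} (hs : 0 ≤ s) (ht : 0 ≤ t) :
    s * t ≤ phiExp s + phiLog t := by
  have hse : s ≤ phiExp s := by
    unfold phiExp
    split_ifs
    · exact le_rfl
    · have := Real.add_one_le_exp (s - 1)
      linarith
  rcases le_or_gt t 1 with h1 | h1
  · have h2 : 0 ≤ phiLog t := mul_nonneg ht (le_max_left _ _)
    nlinarith
  · have ht0 : 0 < t := by linarith
    have hl : phiLog t = t * Real.log t := by
      unfold phiLog
      rw [max_eq_right (Real.log_nonneg h1.le)]
    rw [hl]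
    rcases lt_or_ge s 1 with h3 | h3
    · have h4 := Real.one_sub_inv_le_log_of_pos ht0
      have h5 : t * (1 - t⁻¹) ≤ t * Real.log t := mul_le_mul_of_nonneg_left h4 ht0.le
      have h6 : t * (1 - t⁻¹) = t - 1 := by field_simp
      nlinarith
    · have h7 : phiExp s = Real.exp (s - 1) := by
        unfold phiExp
        rw [if_neg (not_lt.mpr h3)]
      have h4 := Real.add_one_le_exp (s - 1 - Real.log t)
      have h5 : Real.exp (s - 1) = t * Real.exp (s - 1 - Real.log t) := by
        rw [Real.exp_sub (s - 1), Real.exp_log ht0]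
        field_simp
      rw [h7, h5]
      nlinarith

theorem MemLexp.integrable_mul {d : ℕ} {Ω : Set (EuclideanSpace ℝ (Fin d))}
    {u g : EuclideanSpace ℝ (Fin d) → ℝ} (hu : MemLexp Ω u) (hg : MemLlogL Ω g) :
    Integrable (fun x => u x * g x) (normalizedVolume Ω) := by
  obtain ⟨hum, a, ha, hua⟩ := hu
  obtain ⟨hgm, b, hb, hgb⟩ := hg
  have key : Integrable (fun x => (a * |u x|) * (b * |g x|)) (normalizedVolume Ω) := by
    refine ⟨(hum.norm.const_mul a).mul (hgm.norm.const_mul b), ?_⟩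
    have hm : AEMeasurable (fun x => ENNReal.ofReal (phiLog (b * |g x|))) (normalizedVolume Ω) := by
      have : Measurable phiLog := by
        unfold phiLog
        fun_prop
      exact (this.comp_aemeasurable (hgm.norm.aemeasurable.const_mul b)).ennreal_ofReal
    refine lt_of_le_of_lt (lintegral_mono (fun x => ?_))
      ((lintegral_add_right' _ hm).trans_lt (ENNReal.add_lt_top.2 ⟨hua, hgb⟩))
    have h1 : 0 ≤ a * |u x| := by positivity
    have h2 : 0 ≤ b * |g x| := by positivity
    rw [← ofReal_norm, Real.norm_of_nonneg (mul_nonneg h1 h2)]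
    exact (ENNReal.ofReal_le_ofReal (mul_le_phiExp_add_phiLog h1 h2)).trans ENNReal.ofReal_add_le
  refine (key.const_mul (a⁻¹ * b⁻¹)).mono' (hum.mul hgm) (ae_of_all _ fun x => le_of_eq ?_)
  rw [norm_mul, Real.norm_eq_abs, Real.norm_eq_abs]
  field_simp

end

/-!
The theorem rests on two facts about the normalized Lebesgue measure `μ` on `Ω`, which is a
probability measure.

Lower semicontinuity. Each of the three terms of `chi` comes from an integral `∫ F(u) dμ` with `F`
nonnegative, convex and continuously differentiable: `F` is a multiple of `t²`, `exp (t / γ)` or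
`exp (-t / γ)`. If `v` is truncated at the level `m`, the tangent inequality
`F(v) + F'(v) (uₙ - v) ≤ F(uₙ)` on `{|v| ≤ m}` involves only a pairing of `uₙ` with a bounded
function. It passes to the limit, and `m → ∞` then gives `∫ F(v) dμ ≤ liminf ∫ F(uₙ) dμ`
(`lintegral_le_liminf_of_subgradient`), infinite values included. As bounded functions are in
`L log L`, and the logarithm is monotone and continuous on `[0, ∞]`, this gives `chi_le_liminf`.

Compactness. A bounded sequence in `L_exp` is bounded in `L²`, so a subsequence converges weakly
in `L²`. The same lower semicontinuity, for the integrals of `exp (± t / k)`, puts the limit in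
`L_exp`. Test functions in `L log L` are approximated by truncations: Young's inequality between
`phiExp` and `phiLog`, and the `Δ₂`-condition for `phiLog`, make the error uniformly small on
bounded sets of `L_exp` (`exists_bounded_abs_integral_mul_sub_le`). Thus the convergence is weak*
(`exists_subseq_tendstoWeakStarLexp`).

The bound on the norm by the functional is elementary. Jensen's inequality bounds the two
logarithms below by the mean of `u / γ` and its negative, hence the `L²` norm is bounded, hence so
is the mean, and then both exponential integrals are bounded above
(`exists_lexpNorm_le_of_chi_le`).
-/

/-! ### The Young functions `phiExp` and `phiLog` -/

theorem le_phiExp (t : ℝ) : t ≤ phiExp t := by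
  unfold phiExp
  split_ifs
  · exact le_rfl
  · linarith [Real.add_one_le_exp (t - 1)]

theorem phiExp_le_exp (t : ℝ) : phiExp t ≤ Real.exp t := by
  unfold phiExp
  split_ifs
  · linarith [Real.add_one_le_exp t]
  · exact Real.exp_le_exp.2 (by linarith)

theorem phiExp_mono : Monotone phiExp := by
  intro s t hst
  unfold phiExp
  split_ifs
  · exact hst
  · linarith [Real.add_one_le_exp (t - 1)]
  · linarith
  · exact Real.exp_le_exp.2 (by linarith)

theorem measurable_phiExp : Measurable phiExp := phiExp_mono.measurable

theorem measurable_phiLog : Measurable phiLog := by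
  unfold phiLog
  fun_prop

theorem phiLog_nonneg {t : ℝ} (ht : 0 ≤ t) : 0 ≤ phiLog t := mul_nonneg ht (le_max_left _ _)

/-- `phiExp` is convex and vanishes at `0`, so that it is star-shaped. -/
theorem phiExp_mul_le {θ t : ℝ} (h0 : 0 < θ) (h1 : θ ≤ 1) :
    phiExp (θ * t) ≤ θ * phiExp t := by
  by_cases h : θ * t < 1
  · calc phiExp (θ * t) = θ * t := if_pos h
      _ ≤ θ * phiExp t := mul_le_mul_of_nonneg_left (le_phiExp t) h0.le
  · have h' : 1 ≤ θ * t := not_lt.1 h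
    have ht : 0 < t := pos_of_mul_pos_right (by linarith) h0.le
    have ht1 : 1 ≤ t := by nlinarith
    have e1 : phiExp (θ * t) = Real.exp (θ * t - 1) := if_neg h
    have e2 : phiExp t = Real.exp (t - 1) := if_neg (not_lt.2 ht1)
    rw [e1, e2]
    nth_rw 2 [← Real.exp_log h0]
    rw [← Real.exp_add, Real.exp_le_exp]
    have hl := Real.one_sub_inv_le_log_of_pos h0
    have hi : θ⁻¹ ≤ t := by
      rw [inv_le_iff_one_le_mul₀ h0, mul_comm]
      exact h'
    have : (1 - θ) * θ⁻¹ ≤ (1 - θ) * t := mul_le_mul_of_nonneg_left hi (by linarith)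
    have e3 : (1 - θ) * θ⁻¹ = θ⁻¹ - 1 := by field_simp
    linarith

theorem sq_le_two_mul_phiExp {t : ℝ} (ht : 0 ≤ t) : t ^ 2 ≤ 2 * phiExp t := by
  unfold phiExp
  split_ifs with h
  · nlinarith
  · have := Real.quadratic_le_exp_of_nonneg (x := t - 1) (by linarith)
    nlinarith

theorem exp_le_phiExp (t : ℝ) : Real.exp t ≤ Real.exp 1 * (1 + phiExp |t|) := by
  have h : Real.exp t = Real.exp 1 * Real.exp (t - 1) := by
    rw [← Real.exp_add]
    congr 1
    ring
  rw [h]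
  refine mul_le_mul_of_nonneg_left ?_ (Real.exp_pos 1).le
  have h0 := le_phiExp |t|
  have habs := abs_nonneg t
  by_cases h1 : |t| < 1
  · have : Real.exp (t - 1) ≤ 1 := Real.exp_le_one_iff.2 (by linarith [le_abs_self t])
    linarith
  · have e : phiExp |t| = Real.exp (|t| - 1) := if_neg h1
    have : Real.exp (t - 1) ≤ Real.exp (|t| - 1) :=
      Real.exp_le_exp.2 (by linarith [le_abs_self t])
    linarith

/-- The `Δ₂`-condition for `phiLog`. -/
theorem phiLog_mul_le {c t : ℝ} (hc : 0 ≤ c) (ht : 0 ≤ t) :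
    phiLog (c * t) ≤ c * max 0 (Real.log c) * Real.exp 1
      + c * (1 + max 0 (Real.log c)) * phiLog t := by
  have h1 : max 0 (Real.log (c * t)) ≤ max 0 (Real.log c) + max 0 (Real.log t) := by
    simpa only [Real.posLog] using Real.posLog_mul (x := c) (y := t)
  have h2 : t ≤ Real.exp 1 + phiLog t := by
    rcases le_or_gt t (Real.exp 1) with h | h
    · linarith [phiLog_nonneg ht]
    · have hl : 1 ≤ Real.log t := (Real.le_log_iff_exp_le (by linarith [Real.exp_pos 1])).2 h.le
      have : t ≤ phiLog t := le_mul_of_one_le_right ht (hl.trans (le_max_right _ _))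
      linarith [Real.exp_pos 1]
  have h3 : 0 ≤ c * max 0 (Real.log c) := mul_nonneg hc (le_max_left _ _)
  calc phiLog (c * t) ≤ c * t * (max 0 (Real.log c) + max 0 (Real.log t)) :=
        mul_le_mul_of_nonneg_left h1 (mul_nonneg hc ht)
    _ = c * max 0 (Real.log c) * t + c * phiLog t := by unfold phiLog; ring
    _ ≤ c * max 0 (Real.log c) * (Real.exp 1 + phiLog t) + c * phiLog t := by gcongr
    _ = _ := by ring

/-! ### Lower semicontinuity of convex integral functionals -/

/-- The tangent inequality for the convex function `t ↦ exp (c t)`. -/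
theorem exp_subgradient (c a b : ℝ) :
    Real.exp (c * b) + c * Real.exp (c * b) * (a - b) ≤ Real.exp (c * a) := by
  have h := Real.add_one_le_exp (c * a - c * b)
  have e : Real.exp (c * a) = Real.exp (c * b) * Real.exp (c * a - c * b) := by
    rw [← Real.exp_add]
    congr 1
    ring
  rw [e]
  nlinarith [Real.exp_pos (c * b)]

theorem ofReal_integral_le_lintegral_ofReal {α : Type*} [MeasurableSpace α] {μ : Measure α}
    {f : α → ℝ} (hf : Integrable f μ) :
    ENNReal.ofReal (∫ x, f x ∂μ) ≤ ∫⁻ x, ENNReal.ofReal (f x) ∂μ := by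
  refine ENNReal.ofReal_le_of_le_toReal ?_
  rw [integral_eq_lintegral_pos_part_sub_lintegral_neg_part hf]
  exact sub_le_self _ ENNReal.toReal_nonneg

/-- An integral functional with a nonnegative integrand that has an affine minorant at each point,
with continuous slopes, is lower semicontinuous along sequences that converge when tested against
bounded functions. The minorants are taken at the points `v x` and are used only where
`|v x| ≤ m`, so that they are bounded; as `F ≥ 0`, nothing is needed elsewhere. -/
theorem lintegral_le_liminf_of_subgradient {α : Type*} [MeasurableSpace α] {μ : Measure α}
    [IsFiniteMeasure μ] {F F' : ℝ → ℝ} (hF0 : ∀ t, 0 ≤ F t) (hFc : Continuous F)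
    (hF'c : Continuous F') (hF : ∀ a b, F b + F' b * (a - b) ≤ F a)
    {u : ℕ → α → ℝ} {v : α → ℝ} (hu : ∀ n, Integrable (u n) μ) (hv : Integrable v μ)
    (huv : ∀ g : α → ℝ, AEStronglyMeasurable g μ → (∃ C, ∀ x, |g x| ≤ C) →
      Tendsto (fun n => ∫ x, u n x * g x ∂μ) atTop (𝓝 (∫ x, v x * g x ∂μ))) :
    ∫⁻ x, ENNReal.ofReal (F (v x)) ∂μ ≤
      liminf (fun n => ∫⁻ x, ENNReal.ofReal (F (u n x)) ∂μ) atTop := by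
  have trunc_meas : ∀ (G : ℝ → ℝ) (m : ℕ), Continuous G →
      Measurable (fun t : ℝ => if |t| ≤ m then G t else 0) := fun G m hG =>
    Measurable.ite (measurableSet_le measurable_norm measurable_const) hG.measurable
      measurable_const
  have trunc_bdd : ∀ (G : ℝ → ℝ) (m : ℕ), Continuous G →
      ∃ C, ∀ t : ℝ, |if |t| ≤ (m : ℝ) then G t else 0| ≤ C := by
    intro G m hG
    obtain ⟨C, hC⟩ := (isCompact_Icc (a := -(m : ℝ)) (b := m)).exists_bound_of_continuousOn
      hG.continuousOn
    refine ⟨max C 0, fun t => ?_⟩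
    split_ifs with h
    · exact (hC t (abs_le.1 h)).trans (le_max_left _ _)
    · simp
  have trunc_int : ∀ (G : ℝ → ℝ) (m : ℕ), Continuous G →
      Integrable (fun x => if |v x| ≤ (m : ℝ) then G (v x) else 0) μ := by
    intro G m hG
    obtain ⟨C, hC⟩ := trunc_bdd G m hG
    exact Integrable.of_bound
      ((trunc_meas G m hG).comp_aemeasurable hv.aemeasurable).aestronglyMeasurable C
      (ae_of_all _ fun x => hC (v x))
  -- For fixed `m`, the integral of the affine minorant at `v` is an affine functional of `u n`.
  have key : ∀ m : ℕ, ∫⁻ x, ENNReal.ofReal (if |v x| ≤ (m : ℝ) then F (v x) else 0) ∂μ ≤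
      liminf (fun n => ∫⁻ x, ENNReal.ofReal (F (u n x)) ∂μ) atTop := by
    intro m
    set φ : α → ℝ := fun x => if |v x| ≤ (m : ℝ) then F (v x) - F' (v x) * v x else 0 with hφ
    set ψ : α → ℝ := fun x => if |v x| ≤ (m : ℝ) then F' (v x) else 0 with hψ
    have hφi : Integrable φ μ := trunc_int (fun t => F t - F' t * t) m (by fun_prop)
    have hψi : Integrable ψ μ := trunc_int F' m hF'c
    obtain ⟨C, hC⟩ := trunc_bdd F' m hF'c
    have hψC : ∀ x, |ψ x| ≤ C := fun x => hC (v x)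
    have hui : ∀ w : α → ℝ, Integrable w μ → Integrable (fun x => w x * ψ x) μ := fun w hw =>
      hw.mul_bdd (c := C) hψi.aestronglyMeasurable (ae_of_all _ hψC)
    have hlim : Tendsto (fun n => ENNReal.ofReal (∫ x, φ x + u n x * ψ x ∂μ)) atTop
        (𝓝 (∫⁻ x, ENNReal.ofReal (if |v x| ≤ (m : ℝ) then F (v x) else 0) ∂μ)) := by
      rw [← ofReal_integral_eq_lintegral_ofReal (trunc_int F m hFc)
        (ae_of_all _ fun x => by dsimp only; split_ifs <;> simp [hF0])]
      refine (ENNReal.continuous_ofReal.tendsto _).comp ?_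
      have e : ∫ x, (if |v x| ≤ (m : ℝ) then F (v x) else 0) ∂μ
          = ∫ x, φ x ∂μ + ∫ x, v x * ψ x ∂μ := by
        rw [← integral_add hφi (hui v hv)]
        refine integral_congr_ae (ae_of_all _ fun x => ?_)
        simp only [hφ, hψ]
        split_ifs <;> ring
      rw [e]
      simp_rw [fun n => integral_add hφi (hui (u n) (hu n))]
      exact (huv ψ hψi.aestronglyMeasurable ⟨C, hψC⟩).const_add _
    rw [← hlim.liminf_eq]
    refine liminf_le_liminf (Eventually.of_forall fun n => ?_)
    have hi : Integrable (fun x => φ x + u n x * ψ x) μ := hφi.add (hui _ (hu n))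
    refine (ofReal_integral_le_lintegral_ofReal hi).trans
      (lintegral_mono fun x => ENNReal.ofReal_le_ofReal ?_)
    simp only [hφ, hψ]
    split_ifs
    · linarith [hF (u n x) (v x)]
    · simpa using hF0 _
  -- Fatou's lemma removes the truncation.
  calc ∫⁻ x, ENNReal.ofReal (F (v x)) ∂μ
      = ∫⁻ x, liminf (fun m : ℕ =>
          ENNReal.ofReal (if |v x| ≤ (m : ℝ) then F (v x) else 0)) atTop ∂μ := by
        refine lintegral_congr fun x => (Tendsto.liminf_eq ?_).symm
        obtain ⟨N, hN⟩ := exists_nat_ge |v x|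
        refine tendsto_const_nhds.congr' ?_
        filter_upwards [eventually_ge_atTop N] with m hm
        rw [if_pos (hN.trans (by exact_mod_cast hm))]
    _ ≤ liminf (fun m : ℕ =>
          ∫⁻ x, ENNReal.ofReal (if |v x| ≤ (m : ℝ) then F (v x) else 0) ∂μ) atTop :=
        lintegral_liminf_le' fun m => (trunc_int F m hFc).aemeasurable.ennreal_ofReal
    _ ≤ liminf (fun _ : ℕ =>
          liminf (fun n => ∫⁻ x, ENNReal.ofReal (F (u n x)) ∂μ) atTop) atTop :=
        liminf_le_liminf (Eventually.of_forall key)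
    _ = _ := liminf_const _

/-! ### Weak sequential compactness in `L²` -/

/-- Bounded sequences in `L²` of a separable measure have weakly convergent subsequences. -/
theorem exists_subseq_tendsto_integral_mul {α : Type*} [MeasurableSpace α] {μ : Measure α}
    [IsSeparable μ] {u : ℕ → α → ℝ} (hu : ∀ n, MemLp (u n) 2 μ) {R : ℝ}
    (hR : ∀ n, eLpNorm (u n) 2 μ ≤ ENNReal.ofReal R) :
    ∃ (κ : ℕ → ℕ) (v : α → ℝ), StrictMono κ ∧ MemLp v 2 μ ∧ ∀ g : α → ℝ, MemLp g 2 μ →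
      Tendsto (fun n => ∫ x, u (κ n) x * g x ∂μ) atTop (𝓝 (∫ x, v x * g x ∂μ)) := by
  have : Fact ((2 : ℝ≥0∞) ≠ ∞) := ⟨by simp⟩
  let f : ℕ → StrongDual ℝ (Lp ℝ 2 μ) := fun n => InnerProductSpace.toDual ℝ _ ((hu n).toLp (u n))
  have hR' : ∀ n, ‖(hu n).toLp (u n)‖ ≤ max R 0 := fun n => by
    rw [Lp.norm_toLp]
    refine ENNReal.toReal_le_of_le_ofReal (le_max_right _ _)
      ((hR n).trans (ENNReal.ofReal_le_ofReal (le_max_left _ _)))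
  obtain ⟨F, -, κ, hκ, hF⟩ := WeakDual.isSeqCompact_closedBall ℝ (Lp ℝ 2 μ) 0 (max R 0)
    (x := fun n => StrongDual.toWeakDual (f n)) (fun n => by
      simpa [f] using hR' n)
  refine ⟨κ, (InnerProductSpace.toDual ℝ (Lp ℝ 2 μ)).symm (WeakDual.toStrongDual F), hκ, Lp.memLp _,
    fun g hg => ?_⟩
  have h := ((WeakDual.eval_continuous (hg.toLp g)).tendsto F).comp hF
  have e : ∀ (w : Lp ℝ 2 μ), inner ℝ w (hg.toLp g) = ∫ x, w x * g x ∂μ := fun w => by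
    rw [L2.inner_def]
    refine integral_congr_ae ?_
    filter_upwards [hg.coeFn_toLp] with x hx
    simp [hx, mul_comm]
  rw [← e, InnerProductSpace.toDual_symm_apply]
  refine h.congr fun n => ?_
  change inner ℝ ((hu (κ n)).toLp (u (κ n))) (hg.toLp g) = _
  rw [e]
  refine integral_congr_ae ?_
  filter_upwards [(hu (κ n)).coeFn_toLp] with x hx
  rw [hx]

theorem eLpNorm_two_sq {α : Type*} [MeasurableSpace α] {μ : Measure α} (f : α → ℝ) :
    eLpNorm f 2 μ ^ 2 = ∫⁻ x, ENNReal.ofReal (f x ^ 2) ∂μ := by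
  have h := eLpNorm_nnreal_pow_eq_lintegral (f := f) (μ := μ) (p := 2) (by simp)
  simp only [NNReal.coe_ofNat, ENNReal.rpow_ofNat, ENNReal.coe_ofNat] at h
  rw [h]
  refine lintegral_congr fun x => ?_
  rw [Real.enorm_eq_ofReal_abs, ← ENNReal.ofReal_pow (abs_nonneg _), sq_abs]

/-! ### Modular and norm estimates -/

theorem lintegral_le_one_of_luxemburgNorm_lt {α : Type*} [MeasurableSpace α] {μ : Measure α}
    {Φ : ℝ → ℝ} (hΦ : Monotone Φ) {f : α → ℝ} {k : ℝ}
    (h : luxemburgNorm Φ f μ < ENNReal.ofReal k) :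
    ∫⁻ x, ENNReal.ofReal (Φ (|f x| / k)) ∂μ ≤ 1 := by
  unfold luxemburgNorm at h
  simp only [iInf_lt_iff] at h
  obtain ⟨l, hl, hl1, hlk⟩ := h
  have hlk' : l < k := (ENNReal.ofReal_lt_ofReal_iff_of_nonneg hl.le).1 hlk
  refine le_trans (lintegral_mono fun x => ENNReal.ofReal_le_ofReal (hΦ ?_)) hl1
  gcongr

theorem luxemburgNorm_le {α : Type*} [MeasurableSpace α] {μ : Measure α}
    {Φ : ℝ → ℝ} {f : α → ℝ} {k : ℝ} (hk : 0 < k)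
    (h : ∫⁻ x, ENNReal.ofReal (Φ (|f x| / k)) ∂μ ≤ 1) :
    luxemburgNorm Φ f μ ≤ ENNReal.ofReal k :=
  iInf_le_of_le k (iInf_le_of_le hk (iInf_le _ h))

theorem lintegral_exp_le_of_lintegral_phiExp_le {α : Type*} [MeasurableSpace α] {μ : Measure α}
    [IsProbabilityMeasure μ] {f : α → ℝ} {D : ℝ≥0∞}
    (hD : ∫⁻ x, ENNReal.ofReal (phiExp |f x|) ∂μ ≤ D) :
    ∫⁻ x, ENNReal.ofReal (Real.exp (f x)) ∂μ ≤ ENNReal.ofReal (Real.exp 1) * (1 + D) := by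
  calc ∫⁻ x, ENNReal.ofReal (Real.exp (f x)) ∂μ
      ≤ ∫⁻ x, ENNReal.ofReal (Real.exp 1) * (1 + ENNReal.ofReal (phiExp |f x|)) ∂μ := by
        refine lintegral_mono fun x => ?_
        rw [← ENNReal.ofReal_one, ← ENNReal.ofReal_add zero_le_one
          ((abs_nonneg _).trans (le_phiExp _)), ← ENNReal.ofReal_mul (Real.exp_pos 1).le]
        exact ENNReal.ofReal_le_ofReal (exp_le_phiExp _)
    _ = ENNReal.ofReal (Real.exp 1) * (1 + ∫⁻ x, ENNReal.ofReal (phiExp |f x|) ∂μ) := by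
        rw [lintegral_const_mul' _ _ ENNReal.ofReal_ne_top,
          lintegral_add_left measurable_const, lintegral_const, measure_univ, mul_one]
    _ ≤ _ := by gcongr

/-- Follows from `phiExp |t| ≤ exp |t| ≤ exp t + exp (-t)`. -/
theorem lintegral_phiExp_le_of_lintegral_exp {α : Type*} [MeasurableSpace α] {μ : Measure α}
    {f : α → ℝ} (hf : AEMeasurable f μ) :
    ∫⁻ x, ENNReal.ofReal (phiExp |f x|) ∂μ ≤ ∫⁻ x, ENNReal.ofReal (Real.exp (f x)) ∂μ
      + ∫⁻ x, ENNReal.ofReal (Real.exp (-f x)) ∂μ := by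
  rw [← lintegral_add_left' (by fun_prop)]
  refine lintegral_mono fun x => ?_
  refine (ENNReal.ofReal_le_ofReal ((phiExp_le_exp _).trans (?_ : _ ≤
    Real.exp (f x) + Real.exp (-f x)))).trans ENNReal.ofReal_add_le
  rcases abs_cases (f x) with ⟨h, -⟩ | ⟨h, -⟩ <;> rw [h] <;>
    linarith [Real.exp_pos (f x), Real.exp_pos (-f x)]

theorem eLpNorm_two_le_of_lintegral_phiExp_le {α : Type*} [MeasurableSpace α] {μ : Measure α}
    {f : α → ℝ} {k : ℝ} (hk : 0 < k)
    (h : ∫⁻ x, ENNReal.ofReal (phiExp (|f x| / k)) ∂μ ≤ 1) :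
    eLpNorm f 2 μ ≤ ENNReal.ofReal (2 * k) := by
  have h2 : eLpNorm f 2 μ ^ 2 ≤ ENNReal.ofReal (2 * k) ^ 2 := by
    rw [eLpNorm_two_sq]
    calc ∫⁻ x, ENNReal.ofReal (f x ^ 2) ∂μ
        ≤ ∫⁻ x, ENNReal.ofReal (2 * k ^ 2) * ENNReal.ofReal (phiExp (|f x| / k)) ∂μ := by
          refine lintegral_mono fun x => ?_
          rw [← ENNReal.ofReal_mul (by positivity)]
          refine ENNReal.ofReal_le_ofReal ?_
          have := sq_le_two_mul_phiExp (t := |f x| / k) (by positivity)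
          rw [div_pow, sq_abs, div_le_iff₀ (by positivity)] at this
          linarith
      _ = ENNReal.ofReal (2 * k ^ 2) * ∫⁻ x, ENNReal.ofReal (phiExp (|f x| / k)) ∂μ :=
          lintegral_const_mul' _ _ ENNReal.ofReal_ne_top
      _ ≤ ENNReal.ofReal (2 * k ^ 2) * 1 := by gcongr
      _ ≤ ENNReal.ofReal (2 * k) ^ 2 := by
          rw [mul_one, ← ENNReal.ofReal_pow (by positivity)]
          exact ENNReal.ofReal_le_ofReal (by nlinarith)
  exact (ENNReal.pow_le_pow_left_iff two_ne_zero).1 h2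

/-- Jensen's inequality for the exponential, also when the right-hand side is infinite. -/
theorem ofReal_exp_integral_le {α : Type*} [MeasurableSpace α] {μ : Measure α}
    [IsProbabilityMeasure μ] {f : α → ℝ} (hf : Integrable f μ) :
    ENNReal.ofReal (Real.exp (∫ x, f x ∂μ)) ≤ ∫⁻ x, ENNReal.ofReal (Real.exp (f x)) ∂μ := by
  set m := ∫ x, f x ∂μ with hm
  have hs : Integrable (fun x => f x - m) μ := hf.sub (integrable_const m)
  have hi : Integrable (fun x => Real.exp m * (1 + (f x - m))) μ :=
    ((integrable_const _).add hs).const_mul _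
  have e : ∫ x, Real.exp m * (1 + (f x - m)) ∂μ = Real.exp m := by
    rw [integral_const_mul, integral_add (integrable_const _) hs,
      integral_sub hf (integrable_const m)]
    simp [← hm]
  rw [← e]
  refine (ofReal_integral_le_lintegral_ofReal hi).trans
    (lintegral_mono fun x => ENNReal.ofReal_le_ofReal ?_)
  have := exp_subgradient 1 (f x) m
  simp only [one_mul] at this
  linarith

/-! ### The normalized measure and the functional `chi` -/

section

variable {d : ℕ} {Ω : Set (EuclideanSpace ℝ (Fin d))}

theorem isProbabilityMeasure_normalizedVolume (h0 : volume Ω ≠ 0) (hf : volume Ω ≠ ∞) :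
    IsProbabilityMeasure (normalizedVolume Ω) :=
  ProbabilityTheory.cond_isProbabilityMeasure_of_finite h0 hf

theorem restrict_eq_smul_normalizedVolume (h0 : volume Ω ≠ 0) (hf : volume Ω ≠ ∞) :
    volume.restrict Ω = volume Ω • normalizedVolume Ω := by
  rw [normalizedVolume, smul_smul, ENNReal.mul_inv_cancel h0 hf, one_smul]

/-- After scaling, the values of `|g|` are in `[0, 1]`, where `phiLog` vanishes. -/
theorem memLlogL_of_bounded {g : EuclideanSpace ℝ (Fin d) → ℝ}
    (hg : AEStronglyMeasurable g (normalizedVolume Ω)) {C : ℝ} (hC : ∀ x, |g x| ≤ C) :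
    MemLlogL Ω g := by
  have hC0 : 0 ≤ C := (abs_nonneg _).trans (hC 0)
  refine ⟨hg, (C + 1)⁻¹, by positivity, ?_⟩
  have : ∀ x, phiLog ((C + 1)⁻¹ * |g x|) = 0 := fun x => by
    have : (C + 1)⁻¹ * |g x| ≤ 1 := by
      rw [inv_mul_le_iff₀ (by positivity)]
      linarith [hC x]
    rw [phiLog, max_eq_left (Real.log_nonpos (by positivity) this), mul_zero]
  simp [this]

theorem MemLexp.integrable {u : EuclideanSpace ℝ (Fin d) → ℝ} (hu : MemLexp Ω u) :
    Integrable u (normalizedVolume Ω) := by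
  simpa using hu.integrable_mul
    (memLlogL_of_bounded (g := fun _ => 1) aestronglyMeasurable_const (C := 1) (by simp))

/-- The quadratic term of `chi` as an integral with respect to the normalized measure. -/
theorem half_mul_eLpNorm_sq (h0 : volume Ω ≠ 0) (hf : volume Ω ≠ ∞)
    (u : EuclideanSpace ℝ (Fin d) → ℝ) :
    (1 / 2 : ℝ≥0∞) * eLpNorm u 2 (volume.restrict Ω) ^ 2 =
      ∫⁻ x, ENNReal.ofReal ((volume Ω).toReal / 2 * u x ^ 2) ∂(normalizedVolume Ω) := by
  rw [eLpNorm_two_sq, restrict_eq_smul_normalizedVolume h0 hf, lintegral_smul_measure,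
    smul_eq_mul, ← mul_assoc]
  simp_rw [fun x => ENNReal.ofReal_mul (p := (volume Ω).toReal / 2) (q := u x ^ 2) (by positivity)]
  rw [lintegral_const_mul' _ _ ENNReal.ofReal_ne_top]
  congr 1
  rw [ENNReal.ofReal_div_of_pos two_pos, ENNReal.ofReal_toReal hf, mul_comm, ← mul_div_assoc,
    mul_one, ENNReal.ofReal_ofNat]

/-- Sequential weak* lower semicontinuity of `chi`. In `EReal`, the liminf is superadditive without
any side condition, as `⊥ + ⊤ = ⊥`. -/
theorem chi_le_liminf (h0 : volume Ω ≠ 0) (hf : volume Ω ≠ ∞) {γ : ℝ} (hγ : 0 < γ)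
    {u : ℕ → EuclideanSpace ℝ (Fin d) → ℝ} {v : EuclideanSpace ℝ (Fin d) → ℝ}
    (h : TendstoWeakStarLexp Ω u v) :
    chi Ω γ v ≤ liminf (fun n => chi Ω γ (u n)) atTop := by
  obtain ⟨hu, hv, huv⟩ := h
  have := isProbabilityMeasure_normalizedVolume h0 hf
  have lsc := fun (F F' : ℝ → ℝ) h1 h2 h3 h4 =>
    lintegral_le_liminf_of_subgradient (F := F) (F' := F') h1 h2 h3 h4
      (fun n => (hu n).integrable) hv.integrable
      (fun g hg ⟨C, hC⟩ => huv g (memLlogL_of_bounded hg hC))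
  have lsc_log : ∀ c : ℝ, (γ : EReal) * ENNReal.log
        (∫⁻ x, ENNReal.ofReal (Real.exp (c * v x)) ∂(normalizedVolume Ω)) ≤
      liminf (fun n => (γ : EReal) * ENNReal.log
        (∫⁻ x, ENNReal.ofReal (Real.exp (c * u n x)) ∂(normalizedVolume Ω))) atTop := by
    intro c
    have hγ' : (0 : EReal) ≤ γ := by exact_mod_cast hγ.le
    rw [EReal.liminf_const_mul_of_nonneg_of_ne_top hγ' (EReal.coe_ne_top _)]
    refine mul_le_mul_of_nonneg_left ?_ hγ'
    have e := ENNReal.log_monotone.map_liminf_of_continuousAt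
      (F := atTop) (fun n => ∫⁻ x, ENNReal.ofReal (Real.exp (c * u n x)) ∂(normalizedVolume Ω))
      ENNReal.continuous_log.continuousAt
    refine le_trans (ENNReal.log_monotone ?_) e.le
    exact lsc (fun t => Real.exp (c * t)) (fun t => c * Real.exp (c * t))
      (fun t => (Real.exp_pos _).le) (by fun_prop) (by fun_prop) (exp_subgradient c)
  unfold chi
  refine le_trans (add_le_add (add_le_add ?_ (lsc_log γ⁻¹)) ?_)
    ((add_le_add_left EReal.le_liminf_add _).trans EReal.le_liminf_add)
  · simp_rw [half_mul_eLpNorm_sq h0 hf]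
    have e := EReal.coe_ennreal_strictMono.monotone.map_liminf_of_continuousAt (F := atTop)
      (fun n => ∫⁻ x, ENNReal.ofReal ((volume Ω).toReal / 2 * u n x ^ 2) ∂(normalizedVolume Ω))
      continuous_coe_ennreal_ereal.continuousAt
    refine le_trans (EReal.coe_ennreal_strictMono.monotone ?_) e.le
    refine lsc (fun t => (volume Ω).toReal / 2 * t ^ 2) (fun t => (volume Ω).toReal * t)
      (fun t => by positivity) (by fun_prop) (by fun_prop) (fun a b => ?_)
    nlinarith [mul_nonneg (ENNReal.toReal_nonneg (a := volume Ω)) (sq_nonneg (a - b))]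
  · simpa only [neg_mul] using lsc_log (-γ⁻¹)

/-! ### Weak* compactness in `L_exp` -/

theorem MemLlogL.lintegral_phiLog_lt_top [IsFiniteMeasure (normalizedVolume Ω)]
    {g : EuclideanSpace ℝ (Fin d) → ℝ} (hg : MemLlogL Ω g) {L : ℝ} (hL : 0 ≤ L) :
    ∫⁻ x, ENNReal.ofReal (phiLog (L * |g x|)) ∂(normalizedVolume Ω) < ∞ := by
  obtain ⟨-, η, hη, h⟩ := hg
  set c := L / η
  have hc : 0 ≤ c := by positivity
  have hl : 0 ≤ max 0 (Real.log c) := le_max_left _ _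
  refine lt_of_le_of_lt (lintegral_mono (g := fun x =>
    ENNReal.ofReal (c * max 0 (Real.log c) * Real.exp 1)
      + ENNReal.ofReal (c * (1 + max 0 (Real.log c))) * ENNReal.ofReal (phiLog (η * |g x|)))
      fun x => ?_) ?_
  · have h1 : 0 ≤ η * |g x| := by positivity
    have e : L * |g x| = c * (η * |g x|) := by
      simp only [c]
      field_simp
    dsimp only
    rw [← ENNReal.ofReal_mul (by positivity), e]
    exact (ENNReal.ofReal_le_ofReal (phiLog_mul_le hc h1)).trans ENNReal.ofReal_add_le
  · rw [lintegral_add_left measurable_const, lintegral_const_mul' _ _ ENNReal.ofReal_ne_top,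
      lintegral_const]
    exact ENNReal.add_lt_top.2 ⟨ENNReal.mul_lt_top ENNReal.ofReal_lt_top (measure_lt_top _ _),
      ENNReal.mul_lt_top ENNReal.ofReal_lt_top h⟩

/-- Truncations of `g ∈ L log L` approximate `g` uniformly on the bounded sets of `L_exp`, by
Young's inequality for `phiExp` and `phiLog`. -/
theorem exists_bounded_abs_integral_mul_sub_le [IsFiniteMeasure (normalizedVolume Ω)]
    {g : EuclideanSpace ℝ (Fin d) → ℝ} (hg : MemLlogL Ω g) {k ε : ℝ} (hk : 0 < k) (hε : 0 < ε)
    {D : ℝ≥0∞} (hD : D ≠ ∞) :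
    ∃ g' : EuclideanSpace ℝ (Fin d) → ℝ, AEStronglyMeasurable g' (normalizedVolume Ω) ∧
      (∃ C, ∀ x, |g' x| ≤ C) ∧ ∀ w : EuclideanSpace ℝ (Fin d) → ℝ, MemLexp Ω w →
        ∫⁻ x, ENNReal.ofReal (phiExp (|w x| / k)) ∂(normalizedVolume Ω) ≤ D →
        |∫ x, w x * g x ∂(normalizedVolume Ω) - ∫ x, w x * g' x ∂(normalizedVolume Ω)| ≤ ε := by
  set μ := normalizedVolume Ω with hμ
  -- With this scaling Young's inequality bounds the error by `(k / L) * (D + 1) = ε`.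
  set L : ℝ := k * (D.toReal + 1) / ε with hL
  have hL0 : 0 < L := by positivity
  have hpm : AEMeasurable (fun x => ENNReal.ofReal (phiLog (L * |g x|))) μ :=
    (measurable_phiLog.comp_aemeasurable (hg.1.norm.aemeasurable.const_mul L)).ennreal_ofReal
  have hset : ∀ m : ℕ, NullMeasurableSet {x | |g x| ≤ (m : ℝ)} μ := fun m =>
    nullMeasurableSet_le hg.1.norm.aemeasurable aemeasurable_const
  have htail : Tendsto (fun m : ℕ => ∫⁻ x, {x | |g x| ≤ (m : ℝ)}ᶜ.indicator
      (fun x => ENNReal.ofReal (phiLog (L * |g x|))) x ∂μ) atTop (𝓝 (∫⁻ _, 0 ∂μ)) := by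
    refine tendsto_lintegral_of_dominated_convergence'
      (fun x => ENNReal.ofReal (phiLog (L * |g x|)))
      (fun m => hpm.indicator₀ (hset m).compl)
      (fun m => ae_of_all _ fun x => Set.indicator_le_self _ _ _)
      (hg.lintegral_phiLog_lt_top hL0.le).ne (ae_of_all _ fun x => ?_)
    obtain ⟨N, hN⟩ := exists_nat_ge |g x|
    refine tendsto_const_nhds.congr' ?_
    filter_upwards [eventually_ge_atTop N] with m hm
    have : |g x| ≤ (m : ℝ) := hN.trans (by exact_mod_cast hm)
    simp [this]
  rw [lintegral_zero] at htail
  obtain ⟨m, hm⟩ := (htail.eventually_lt_const zero_lt_one).exists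
  have hg'm : AEStronglyMeasurable ({x | |g x| ≤ (m : ℝ)}.indicator g) μ :=
    hg.1.indicator₀ (hset m)
  have hg'b : ∀ x, |{x | |g x| ≤ (m : ℝ)}.indicator g x| ≤ m := fun x => by
    by_cases h : |g x| ≤ (m : ℝ) <;> simp [h]
  refine ⟨_, hg'm, ⟨m, hg'b⟩, fun w hw hwD => ?_⟩
  rw [← integral_sub (hw.integrable_mul hg) (hw.integrable_mul (memLlogL_of_bounded hg'm hg'b)),
    ← Real.norm_eq_abs]
  refine (norm_integral_le_lintegral_norm _).trans (ENNReal.toReal_le_of_le_ofReal hε.le ?_)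
  have hwm : AEMeasurable (fun x => ENNReal.ofReal (phiExp (|w x| / k))) μ :=
    (measurable_phiExp.comp_aemeasurable (hw.1.norm.aemeasurable.div_const k)).ennreal_ofReal
  calc ∫⁻ x, ENNReal.ofReal ‖w x * g x - w x * {x | |g x| ≤ (m : ℝ)}.indicator g x‖ ∂μ
      ≤ ∫⁻ x, ENNReal.ofReal (k / L) * (ENNReal.ofReal (phiExp (|w x| / k))
        + {x | |g x| ≤ (m : ℝ)}ᶜ.indicator
          (fun x => ENNReal.ofReal (phiLog (L * |g x|))) x) ∂μ := by
        refine lintegral_mono fun x => ?_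
        by_cases h : |g x| ≤ (m : ℝ)
        · simp [h]
        · have h1 := mul_le_phiExp_add_phiLog (s := |w x| / k) (t := L * |g x|)
            (by positivity) (by positivity)
          have e : ‖w x * g x‖ = k / L * (|w x| / k * (L * |g x|)) := by
            rw [norm_mul, Real.norm_eq_abs, Real.norm_eq_abs]
            field_simp
          simp only [Set.indicator, Set.mem_ofPred_eq, Set.mem_compl_iff, h, not_false_eq_true,
            if_true, if_false, mul_zero, sub_zero]
          rw [e, ENNReal.ofReal_mul (by positivity)]
          gcongr
          exact (ENNReal.ofReal_le_ofReal h1).trans ENNReal.ofReal_add_le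
    _ = ENNReal.ofReal (k / L) * (∫⁻ x, ENNReal.ofReal (phiExp (|w x| / k)) ∂μ
        + ∫⁻ x, {x | |g x| ≤ (m : ℝ)}ᶜ.indicator
          (fun x => ENNReal.ofReal (phiLog (L * |g x|))) x ∂μ) := by
        rw [lintegral_const_mul' _ _ ENNReal.ofReal_ne_top, lintegral_add_left' hwm]
    _ ≤ ENNReal.ofReal (k / L) * (D + 1) := by gcongr
    _ = ENNReal.ofReal ε := by
        rw [← ENNReal.ofReal_toReal hD, ← ENNReal.ofReal_one,
          ← ENNReal.ofReal_add ENNReal.toReal_nonneg zero_le_one,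
          ← ENNReal.ofReal_mul (by positivity), hL]
        congr 1
        field_simp

/-- On bounded sets of `L_exp`, convergence tested against bounded functions is weak* convergence. -/
theorem tendstoWeakStarLexp_of_bounded [IsFiniteMeasure (normalizedVolume Ω)]
    {u : ℕ → EuclideanSpace ℝ (Fin d) → ℝ} {v : EuclideanSpace ℝ (Fin d) → ℝ}
    (hu : ∀ n, MemLexp Ω (u n)) (hv : MemLexp Ω v) {k : ℝ} (hk : 0 < k) {D : ℝ≥0∞} (hD : D ≠ ∞)
    (huD : ∀ n, ∫⁻ x, ENNReal.ofReal (phiExp (|u n x| / k)) ∂(normalizedVolume Ω) ≤ D)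
    (hvD : ∫⁻ x, ENNReal.ofReal (phiExp (|v x| / k)) ∂(normalizedVolume Ω) ≤ D)
    (huv : ∀ g : EuclideanSpace ℝ (Fin d) → ℝ, AEStronglyMeasurable g (normalizedVolume Ω) →
      (∃ C, ∀ x, |g x| ≤ C) → Tendsto (fun n => ∫ x, u n x * g x ∂(normalizedVolume Ω)) atTop
        (𝓝 (∫ x, v x * g x ∂(normalizedVolume Ω)))) :
    TendstoWeakStarLexp Ω u v := by
  refine ⟨hu, hv, fun g hg => Metric.tendsto_atTop.2 fun ε hε => ?_⟩
  obtain ⟨g', hg'm, hg'b, happ⟩ :=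
    exists_bounded_abs_integral_mul_sub_le hg hk (ε := ε / 4) (by positivity) hD
  obtain ⟨N, hN⟩ := Metric.tendsto_atTop.1 (huv g' hg'm hg'b) (ε / 4) (by positivity)
  refine ⟨N, fun n hn => ?_⟩
  have h1 := abs_le.1 (happ (u n) (hu n) (huD n))
  have h2 := abs_le.1 (happ v hv hvD)
  have h3 := hN n hn
  rw [Real.dist_eq, abs_lt] at h3 ⊢
  constructor <;> linarith [h1.1, h1.2, h2.1, h2.2, h3.1, h3.2]

/-- Sequential weak* compactness of the bounded sets of `L_exp`. A weak limit in `L²` is taken;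
lower semicontinuity of the exponential integrals shows that it is in `L_exp`. -/
theorem exists_subseq_tendstoWeakStarLexp (h0 : volume Ω ≠ 0) (hf : volume Ω ≠ ∞)
    {u : ℕ → EuclideanSpace ℝ (Fin d) → ℝ} (hu : ∀ n, MemLexp Ω (u n)) {C : ℝ≥0}
    (hC : ∀ n, lexpNorm Ω (u n) ≤ C) :
    ∃ (κ : ℕ → ℕ) (v : EuclideanSpace ℝ (Fin d) → ℝ), StrictMono κ ∧
      TendstoWeakStarLexp Ω (fun n => u (κ n)) v := by
  have := isProbabilityMeasure_normalizedVolume h0 hf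
  set μ := normalizedVolume Ω with hμ
  -- The infimum in the Luxemburg norm need not be attained a priori, hence `k > C`.
  set k : ℝ := C + 1 with hk
  have hk0 : 0 < k := by positivity
  have hu1 : ∀ n, ∫⁻ x, ENNReal.ofReal (phiExp (|u n x| / k)) ∂μ ≤ 1 := fun n => by
    refine lintegral_le_one_of_luxemburgNorm_lt phiExp_mono ((hC n).trans_lt ?_)
    rw [← ENNReal.ofReal_coe_nnreal]
    exact (ENNReal.ofReal_lt_ofReal_iff hk0).2 (lt_add_one _)
  have hu2 : ∀ n, eLpNorm (u n) 2 μ ≤ ENNReal.ofReal (2 * k) := fun n =>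
    eLpNorm_two_le_of_lintegral_phiExp_le hk0 (hu1 n)
  have hu3 : ∀ n, MemLp (u n) 2 μ := fun n => ⟨(hu n).1, (hu2 n).trans_lt ENNReal.ofReal_lt_top⟩
  obtain ⟨κ, v, hκ, hv, hlim⟩ := exists_subseq_tendsto_integral_mul hu3 hu2
  have hlim' : ∀ g : EuclideanSpace ℝ (Fin d) → ℝ, AEStronglyMeasurable g μ →
      (∃ C, ∀ x, |g x| ≤ C) → Tendsto (fun n => ∫ x, u (κ n) x * g x ∂μ) atTop
        (𝓝 (∫ x, v x * g x ∂μ)) := fun g hg ⟨C, hC⟩ =>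
    hlim g (MemLp.of_bound hg C (ae_of_all _ hC))
  set E : ℝ≥0∞ := ENNReal.ofReal (Real.exp 1) * (1 + 1) with hE
  have hE_top : E ≠ ∞ := ENNReal.mul_ne_top ENNReal.ofReal_ne_top (by simp)
  have hvexp : ∀ c : ℝ, |c| = k⁻¹ → ∫⁻ x, ENNReal.ofReal (Real.exp (c * v x)) ∂μ ≤ E := by
    intro c hc
    refine (lintegral_le_liminf_of_subgradient (F := fun t => Real.exp (c * t))
      (F' := fun t => c * Real.exp (c * t)) (fun t => (Real.exp_pos _).le) (by fun_prop)
      (by fun_prop) (exp_subgradient c) (fun n => (hu (κ n)).integrable)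
      (hv.integrable one_le_two) hlim').trans ?_
    refine (liminf_le_liminf (Eventually.of_forall fun n => ?_)).trans_eq (liminf_const E)
    refine lintegral_exp_le_of_lintegral_phiExp_le ?_
    simpa only [abs_mul, hc, div_eq_inv_mul] using hu1 (κ n)
  have hk_abs : |k⁻¹| = k⁻¹ := abs_of_pos (inv_pos.2 hk0)
  have hvD : ∫⁻ x, ENNReal.ofReal (phiExp (|v x| / k)) ∂μ ≤ E + E := by
    have h1 := lintegral_phiExp_le_of_lintegral_exp
      (hv.aestronglyMeasurable.aemeasurable.const_mul k⁻¹)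
    simp only [abs_mul, hk_abs] at h1
    simp only [div_eq_inv_mul]
    refine h1.trans (add_le_add (hvexp _ hk_abs) ?_)
    simpa only [neg_mul] using hvexp (-k⁻¹) (by rw [abs_neg, hk_abs])
  have hD_top : E + E ≠ ∞ := ENNReal.add_ne_top.2 ⟨hE_top, hE_top⟩
  have h1E : 1 ≤ E + E := by
    have : (1 : ℝ≥0∞) ≤ ENNReal.ofReal (Real.exp 1) :=
      ENNReal.one_le_ofReal.2 (Real.one_le_exp zero_le_one)
    calc (1 : ℝ≥0∞) ≤ 1 * (1 + 1) := by rw [one_mul]; exact le_self_add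
      _ ≤ E := by rw [hE]; gcongr
      _ ≤ E + E := le_self_add
  refine ⟨κ, v, hκ, tendstoWeakStarLexp_of_bounded (fun n => hu _) ⟨hv.1, k⁻¹, inv_pos.2 hk0, ?_⟩
    hk0 hD_top (fun n => (hu1 _).trans h1E) hvD hlim'⟩
  simpa only [div_eq_inv_mul] using hvD.trans_lt hD_top.lt_top

/-! ### Coercivity of `chi` -/

/-- Sublevel sets of `chi` are bounded in `L_exp`. If `m` is the mean of `u / γ`, Jensen's
inequality bounds the two logarithms below by `m` and `-m`. Hence their sum is nonnegative, so
that `u` is bounded in `L²` and `m` is bounded, and then each logarithm is bounded above. -/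
theorem exists_lexpNorm_le_of_chi_le (h0 : volume Ω ≠ 0) (hf : volume Ω ≠ ∞) {γ : ℝ} (hγ : 0 < γ)
    (M : ℝ) : ∃ C : ℝ≥0, ∀ u : EuclideanSpace ℝ (Fin d) → ℝ, MemLp u 2 (volume.restrict Ω) →
      chi Ω γ u ≤ (M : EReal) → MemLexp Ω u ∧ lexpNorm Ω u ≤ C := by
  have := isProbabilityMeasure_normalizedVolume h0 hf
  set μ := normalizedVolume Ω with hμ
  set V := (volume Ω).toReal with hV
  have hV0 : 0 < V := ENNReal.toReal_pos h0 hf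
  set c : ℝ := γ⁻¹ * M + γ⁻¹ * ((1 + 2 / V * M) / 2) with hc
  set K : ℝ := 2 * Real.exp |c| with hK
  have hK1 : 1 ≤ K := by linarith [Real.one_le_exp (abs_nonneg c)]
  have hK0 : 0 < K := by linarith
  refine ⟨(γ * K).toNNReal, fun u hu hM => ?_⟩
  have huμ : MemLp u 2 μ := hu.smul_measure (ENNReal.inv_ne_top.2 h0)
  have hui : Integrable u μ := huμ.integrable one_le_two
  have husq : Integrable (fun x => u x ^ 2) μ := huμ.integrable_sq
  have hum : AEMeasurable u μ := hui.aemeasurable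
  set m : ℝ := ∫ x, γ⁻¹ * u x ∂μ with hm
  set t : ℝ := ∫ x, V / 2 * u x ^ 2 ∂μ with ht
  set A := ∫⁻ x, ENNReal.ofReal (Real.exp (γ⁻¹ * u x)) ∂μ with hA
  set B := ∫⁻ x, ENNReal.ofReal (Real.exp (-(γ⁻¹ * u x))) ∂μ with hB
  have hAm : ENNReal.ofReal (Real.exp m) ≤ A := ofReal_exp_integral_le (hui.const_mul _)
  have hBm : ENNReal.ofReal (Real.exp (-m)) ≤ B := by
    rw [hm, ← integral_neg]
    exact ofReal_exp_integral_le (hui.const_mul _).neg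
  have hA0 : 0 < A := (ENNReal.ofReal_pos.2 (Real.exp_pos _)).trans_le hAm
  have hB0 : 0 < B := (ENNReal.ofReal_pos.2 (Real.exp_pos _)).trans_le hBm
  have ht0 : 0 ≤ t := integral_nonneg fun x => by positivity
  have hchi : ((t : ℝ) : EReal) + γ * ENNReal.log A + γ * ENNReal.log B ≤ M := by
    unfold chi at hM
    rw [half_mul_eLpNorm_sq h0 hf, ← ofReal_integral_eq_lintegral_ofReal (husq.const_mul _)
      (ae_of_all _ fun x => by positivity), EReal.coe_ennreal_ofReal, max_eq_left ht0] at hM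
    exact hM
  have hγlog : ∀ X : ℝ≥0∞, 0 < X → (γ : EReal) * ENNReal.log X ≠ ⊥ := fun X hX => by
    rcases eq_or_ne X ∞ with rfl | hX'
    · simp [EReal.coe_mul_top_of_pos hγ]
    · rw [ENNReal.log_pos_real hX.ne' hX', ← EReal.coe_mul]
      exact EReal.coe_ne_bot _
  -- As neither logarithm is `⊥`, an infinite integral would make `chi` infinite.
  have hA_top : A ≠ ∞ := by
    intro h
    rw [h, ENNReal.log_top, EReal.coe_mul_top_of_pos hγ, EReal.coe_add_top,
      EReal.top_add_of_ne_bot (hγlog B hB0)] at hchi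
    exact absurd hchi (not_le.2 (EReal.coe_lt_top M))
  have hB_top : B ≠ ∞ := by
    intro h
    rw [h, ENNReal.log_top, EReal.coe_mul_top_of_pos hγ, EReal.add_top_of_ne_bot] at hchi
    · exact absurd hchi (not_le.2 (EReal.coe_lt_top M))
    · rw [ENNReal.log_pos_real hA0.ne' hA_top, ← EReal.coe_mul, ← EReal.coe_add]
      exact EReal.coe_ne_bot _
  rw [ENNReal.log_pos_real hA0.ne' hA_top, ENNReal.log_pos_real hB0.ne' hB_top] at hchi
  have ha0 : 0 < A.toReal := ENNReal.toReal_pos hA0.ne' hA_top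
  have hb0 : 0 < B.toReal := ENNReal.toReal_pos hB0.ne' hB_top
  have ha : m ≤ Real.log A.toReal :=
    (Real.le_log_iff_exp_le ha0).2 ((ENNReal.ofReal_le_iff_le_toReal hA_top).1 hAm)
  have hb : -m ≤ Real.log B.toReal :=
    (Real.le_log_iff_exp_le hb0).2 ((ENNReal.ofReal_le_iff_le_toReal hB_top).1 hBm)
  set a := Real.log A.toReal with ha_def
  set b := Real.log B.toReal with hb_def
  have hreal : t + γ * a + γ * b ≤ M := by exact_mod_cast hchi
  have htM : t ≤ M := by nlinarith
  have hmt : |m| ≤ γ⁻¹ * ((1 + 2 / V * M) / 2) := by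
    have h1 : |∫ x, u x ∂μ| ≤ (1 + 2 / V * t) / 2 := by
      have e : (1 + 2 / V * t) / 2 = ∫ x, (1 + u x ^ 2) / 2 ∂μ := by
        rw [integral_div, integral_add (integrable_const _) husq, ht, integral_const_mul]
        simp only [integral_const, probReal_univ, smul_eq_mul, mul_one]
        field_simp
      rw [e]
      refine (abs_integral_le_integral_abs).trans (integral_mono hui.abs
        (((integrable_const _).add husq).div_const 2) fun x => ?_)
      have := sq_nonneg (|u x| - 1)
      simp only
      nlinarith [sq_abs (u x)]
    rw [hm, integral_const_mul, abs_mul, abs_of_pos (inv_pos.2 hγ)]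
    refine mul_le_mul_of_nonneg_left (h1.trans ?_) (inv_pos.2 hγ).le
    gcongr
  have hab : a + b ≤ γ⁻¹ * M := by
    rw [le_inv_mul_iff₀ hγ]
    nlinarith
  have hac : a ≤ |c| := by linarith [le_abs_self c, (abs_le.1 hmt).2]
  have hbc : b ≤ |c| := by linarith [le_abs_self c, (abs_le.1 hmt).1]
  have hAc : A ≤ ENNReal.ofReal (Real.exp |c|) := by
    rw [← ENNReal.ofReal_toReal hA_top, ← Real.exp_log ha0]
    exact ENNReal.ofReal_le_ofReal (Real.exp_le_exp.2 hac)
  have hBc : B ≤ ENNReal.ofReal (Real.exp |c|) := by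
    rw [← ENNReal.ofReal_toReal hB_top, ← Real.exp_log hb0]
    exact ENNReal.ofReal_le_ofReal (Real.exp_le_exp.2 hbc)
  have hphi : ∫⁻ x, ENNReal.ofReal (phiExp (γ⁻¹ * |u x|)) ∂μ ≤ ENNReal.ofReal K := by
    have h1 := lintegral_phiExp_le_of_lintegral_exp (hum.const_mul γ⁻¹)
    simp only [abs_mul, abs_of_pos (inv_pos.2 hγ)] at h1
    refine h1.trans ((add_le_add hAc hBc).trans_eq ?_)
    rw [← ENNReal.ofReal_add (Real.exp_pos _).le (Real.exp_pos _).le, hK, two_mul]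
  refine ⟨⟨hui.1, γ⁻¹, inv_pos.2 hγ, hphi.trans_lt ENNReal.ofReal_lt_top⟩, ?_⟩
  refine luxemburgNorm_le (mul_pos hγ hK0) ?_
  -- `phiExp` is star-shaped, so that dividing `u / γ` by `K ≥ 1` divides the bound `K` by `K`.
  calc ∫⁻ x, ENNReal.ofReal (phiExp (|u x| / (γ * K))) ∂μ
      ≤ ∫⁻ x, ENNReal.ofReal K⁻¹ * ENNReal.ofReal (phiExp (γ⁻¹ * |u x|)) ∂μ := by
        refine lintegral_mono fun x => ?_
        rw [← ENNReal.ofReal_mul (inv_pos.2 hK0).le]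
        have e : |u x| / (γ * K) = K⁻¹ * (γ⁻¹ * |u x|) := by field_simp
        rw [e]
        exact ENNReal.ofReal_le_ofReal (phiExp_mul_le (inv_pos.2 hK0) (inv_le_one_of_one_le₀ hK1))
    _ ≤ ENNReal.ofReal K⁻¹ * ENNReal.ofReal K := by
        rw [lintegral_const_mul' _ _ ENNReal.ofReal_ne_top]
        gcongr
    _ = 1 := by
        rw [← ENNReal.ofReal_mul (inv_pos.2 hK0).le, inv_mul_cancel₀ hK0.ne', ENNReal.ofReal_one]

end

theorem mainTheorem11 (d : ℕ) (hd : 1 ≤ d) (Ω : Set (EuclideanSpace ℝ (Fin d)))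
    (hΩo : IsOpen Ω) (hΩn : Ω.Nonempty) (hΩb : Bornology.IsBounded Ω)
    (γ : ℝ) (hγ : 0 < γ) :
    -- bounded sequences have a weak* convergent subsequence satisfying the liminf inequality
    (∀ u : ℕ → EuclideanSpace ℝ (Fin d) → ℝ,
      (∀ n, MemLexp Ω (u n)) → (∃ C : ℝ≥0, ∀ n, lexpNorm Ω (u n) ≤ C) →
      ∃ (κ : ℕ → ℕ) (v : EuclideanSpace ℝ (Fin d) → ℝ), StrictMono κ ∧ MemLexp Ω v ∧
        TendstoWeakStarLexp Ω (fun n => u (κ n)) v ∧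
        chi Ω γ v ≤ liminf (fun n => chi Ω γ (u (κ n))) atTop) ∧
    -- sequential weak* lower semicontinuity
    (∀ (u : ℕ → EuclideanSpace ℝ (Fin d) → ℝ) (v : EuclideanSpace ℝ (Fin d) → ℝ),
      TendstoWeakStarLexp Ω u v →
      chi Ω γ v ≤ liminf (fun n => chi Ω γ (u n)) atTop) ∧
    -- bounds on the functional give bounds on the norm
    (∀ u : ℕ → EuclideanSpace ℝ (Fin d) → ℝ,
      (∀ n, MemLp (u n) 2 (volume.restrict Ω)) →
      (∃ M : ℝ, ∀ n, chi Ω γ (u n) ≤ (M : EReal)) →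
      (∀ n, MemLexp Ω (u n)) ∧ ∃ C : ℝ≥0, ∀ n, lexpNorm Ω (u n) ≤ C) := by
  have h0 : volume Ω ≠ 0 := (hΩo.measure_pos volume hΩn).ne'
  have hf : volume Ω ≠ ∞ := hΩb.measure_lt_top.ne
  refine ⟨fun u hu ⟨C, hC⟩ => ?_, fun u v h => chi_le_liminf h0 hf hγ h, fun u hu ⟨M, hM⟩ => ?_⟩
  · obtain ⟨κ, v, hκ, h⟩ := exists_subseq_tendstoWeakStarLexp h0 hf hu hC
    exact ⟨κ, v, hκ, h.2.1, h, chi_le_liminf h0 hf hγ h⟩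
  · obtain ⟨C, hC⟩ := exists_lexpNorm_le_of_chi_le h0 hf hγ M
    exact ⟨fun n => (hC _ (hu n) (hM n)).1, C, fun n => (hC _ (hu n) (hM n)).2⟩
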